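/- Let $n\ge 1$. A Gelfand–Tsetlin triangle of size $n$ is an array $X=(X_{i,j})_{n\ge i\ge j\ge 1}$ of positive integers with $X_{i+1,j}\le X_{i,j}\le X_{i+1,j+1}$ for $n-1\ge i\ge j\ge 1$; triangles are ordered entrywise. For $1\le k\le n-1$ let $s_k$ be the map on Gelfand–Tsetlin triangles which changes only row $k$, replacing $X_{k,j}$ by $$\max(X_{k+1,j},X_{k-1,j-1})+\min(X_{k+1,j+1},X_{k-1,j})-X_{k,j},$$ where an entry $X_{k-1,j-1}$ or $X_{k-1,j}$ that does not exist is omitted from the maximum or minimum. Put $\omega_j=s_js_{j-1}\cdots s_1$; the Schützenberger involution is $S=\omega_1\omega_2\cdots\omega_{n-1}$ (compositions of maps). A Magog triangle is a Gelfand–Tsetlin triangle with $X_{j,j}\le j$ for $1\le j\le n$, and a GOGAm triangle is a Gelfand–Tsetlin triangle $X$ such that $S(X)$ is a Magog triangle. For $1\le k\le n$, an $(n,k)$ right (respectively left) GOGAm trapezoid is an array indexed by the pairs $n\ge i\ge j\ge1$ with $i-j\le k-1$ (respectively with $j\le k$) which is the restriction to these positions of some GOGAm triangle of size $n$. **Proposition.**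 Let $1\le k\le n$. 1. For every $(n,k)$ right GOGAm trapezoid $X$ there is a smallest GOGAm triangle of size $n$ that extends $X$ (its canonical completion). Its added entries are $X_{i,j}=1$ for $n\ge i\ge j+k$, $j\ge 1$. 2. For every $(n,k)$ left GOGAm trapezoid $X$ there is a smallest GOGAm triangle of size $n$ that extends $X$ (its canonical completion). It satisfies $X_{i,j}=X_{i-j+k,k}$ for $n\ge i\ge j\ge k$; that is, the added entries are constant on SW–NE diagonals. -/

import Mathlib

/-- The positions `(i, j)` with `n ≥ i ≥ j ≥ 1` of a triangular array of size `n`;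
`i` is the row (row `n` is the top one) and `j` the place in the row. -/
def triangleIndex (n : ℕ) : Finset (ℕ × ℕ) :=
  (Finset.Icc 1 n ×ˢ Finset.Icc 1 n).filter fun p => p.2 ≤ p.1

/-- The positions on the `k` rightmost SW-NE diagonals, `i - j ≤ k - 1`. -/
def rightIndex (n k : ℕ) : Finset (ℕ × ℕ) :=
  (triangleIndex n).filter fun p => p.1 < p.2 + k

/-- The positions on the `k` leftmost NW-SE diagonals, `j ≤ k`. -/
def leftIndex (n k : ℕ) : Finset (ℕ × ℕ) :=
  (triangleIndex n).filter fun p => p.2 ≤ k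

theorem rightIndex_subset (n k : ℕ) : rightIndex n k ⊆ triangleIndex n :=
  Finset.filter_subset _ _

theorem leftIndex_subset (n k : ℕ) : leftIndex n k ⊆ triangleIndex n :=
  Finset.filter_subset _ _

/-- Arrays of integers with set of positions `s`. The order `≤` on them is the entrywise one. -/
abbrev IntArray (s : Finset (ℕ × ℕ)) : Type := s → ℤ

/-- The entry `X_{i,j}`, with the value `0` when `(i, j)` is not a position of the array. -/
def IntArray.entry {s : Finset (ℕ × ℕ)} (X : IntArray s) (i j : ℕ) : ℤ :=
  if h : (i, j) ∈ s then X ⟨(i, j), h⟩ else 0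

/-- Gelfand-Tsetlin triangles of size `n` (with positive entries). -/
structure IsGelfandTsetlin {n : ℕ} (X : IntArray (triangleIndex n)) : Prop where
  pos : ∀ p, 0 < X p
  interlace : ∀ i j : ℕ, 1 ≤ j → j ≤ i → i + 1 ≤ n →
    X.entry (i + 1) j ≤ X.entry i j ∧ X.entry i j ≤ X.entry (i + 1) (j + 1)

/-- The map `s_k`, used for `1 ≤ k ≤ n - 1`: the entries of row `k` are replaced by
`max (X_{k+1,j}, X_{k-1,j-1}) + min (X_{k+1,j+1}, X_{k-1,j}) - X_{k,j}`, where the entry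
`X_{k-1,j-1}` is left out of the maximum for `j = 1`, and the entry `X_{k-1,j}` is left out
of the minimum for `j = k`, since they do not exist. -/
def rowReflection {n : ℕ} (k : ℕ) (X : IntArray (triangleIndex n)) :
    IntArray (triangleIndex n) := fun p =>
  let j := p.1.2
  if p.1.1 = k then
    (if j = 1 then X.entry (k + 1) j else max (X.entry (k + 1) j) (X.entry (k - 1) (j - 1)))
      + (if j = k then X.entry (k + 1) (j + 1)
          else min (X.entry (k + 1) (j + 1)) (X.entry (k - 1) j))
      - X p
  else X p

/-- `ω_j = s_j s_{j-1} ⋯ s_1`, so that `s_1` acts first. -/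
def rowSweep {n : ℕ} : ℕ → IntArray (triangleIndex n) → IntArray (triangleIndex n)
  | 0 => id
  | j + 1 => rowReflection (j + 1) ∘ rowSweep j

/-- `ω_1 ω_2 ⋯ ω_m`, so that `ω_m` acts first. -/
def sweepProduct {n : ℕ} : ℕ → IntArray (triangleIndex n) → IntArray (triangleIndex n)
  | 0 => id
  | m + 1 => sweepProduct m ∘ rowSweep (m + 1)

/-- The Schützenberger involution `S = ω_1 ω_2 ⋯ ω_{n-1}` on triangles of size `n`. -/
def schutzenberger {n : ℕ} (X : IntArray (triangleIndex n)) : IntArray (triangleIndex n) :=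
  sweepProduct (n - 1) X

/-- Magog triangles: Gelfand-Tsetlin triangles with `X_{j,j} ≤ j`. -/
structure IsMagog {n : ℕ} (X : IntArray (triangleIndex n)) : Prop where
  gelfandTsetlin : IsGelfandTsetlin X
  diagonal : ∀ j : ℕ, 1 ≤ j → j ≤ n → X.entry j j ≤ j

/-- GOGAm triangles: Gelfand-Tsetlin triangles whose image under the Schützenberger
involution is a Magog triangle. -/
structure IsGOGAm {n : ℕ} (X : IntArray (triangleIndex n)) : Prop where
  gelfandTsetlin : IsGelfandTsetlin X
  magog : IsMagog (schutzenberger X)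

/-- The triangle `T` extends the right trapezoidal array `X`. -/
def ExtendsRight {n k : ℕ} (T : IntArray (triangleIndex n)) (X : IntArray (rightIndex n k)) :
    Prop :=
  ∀ p (hp : p ∈ rightIndex n k), T ⟨p, rightIndex_subset n k hp⟩ = X ⟨p, hp⟩

/-- The triangle `T` extends the left trapezoidal array `X`. -/
def ExtendsLeft {n k : ℕ} (T : IntArray (triangleIndex n)) (X : IntArray (leftIndex n k)) :
    Prop :=
  ∀ p (hp : p ∈ leftIndex n k), T ⟨p, leftIndex_subset n k hp⟩ = X ⟨p, hp⟩

/-- `(n, k)` right GOGAm trapezoids. -/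
def IsRightGOGAmTrapezoid {n k : ℕ} (X : IntArray (rightIndex n k)) : Prop :=
  ∃ T : IntArray (triangleIndex n), IsGOGAm T ∧ ExtendsRight T X

/-- `(n, k)` left GOGAm trapezoids. -/
def IsLeftGOGAmTrapezoid {n k : ℕ} (X : IntArray (leftIndex n k)) : Prop :=
  ∃ T : IntArray (triangleIndex n), IsGOGAm T ∧ ExtendsLeft T X

/-- `C` is the canonical completion of the right trapezoid `X`: the smallest GOGAm triangle
that extends it. -/
def IsRightCompletion {n k : ℕ} (X : IntArray (rightIndex n k))
    (C : IntArray (triangleIndex n)) : Prop :=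
  IsLeast {T : IntArray (triangleIndex n) | IsGOGAm T ∧ ExtendsRight T X} C

/-- `C` is the canonical completion of the left trapezoid `X`: the smallest GOGAm triangle
that extends it. -/
def IsLeftCompletion {n k : ℕ} (X : IntArray (leftIndex n k))
    (C : IntArray (triangleIndex n)) : Prop :=
  IsLeast {T : IntArray (triangleIndex n) | IsGOGAm T ∧ ExtendsLeft T X} C

/-! Read a triangle as a semistandard tableau: with 1 subtracted from every entry, row `i` is the
shape formed by the letters at most `i`. Then `S(X)_{j,j} - 1` is the maximal length of a weakly
increasing subsequence of the letters above `n - j`, tableau rows being read from the bottom up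
(`IsGelfandTsetlin.entry_sweepProduct`). Such a last passage value is monotone in the number of each
letter in each row, so a Gelfand-Tsetlin triangle with fewer letters than a GOGAm triangle is again
GOGAm (`IsGOGAm.of_letterCount_le`). Both completions arise from an arbitrary GOGAm extension by
removing letters; they are smallest by positivity, respectively by monotonicity along SW-NE
diagonals.

The formula holds because each sweep deletes the letter 1, rectifies and renumbers, and
rectification preserves last passage values (`IsPromotion.lastPassage_eq`). That invariance comes
from the two-line identity `passageLine_queue`, applied to adjacent rows from the bottom up. -/

/-! ### Last passage values -/

/-- One line of a last passage recursion, with inflow `Φ` from the line below and weights `q`. -/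
def passageLine (Φ q : ℕ → ℤ) : ℕ → ℤ
  | 0 => 0
  | b + 1 => max (passageLine Φ q b) (Φ (b + 1)) + q b

theorem passageLine_mono {Φ Φ' q q' : ℕ → ℤ} {B : ℕ} (hΦ : ∀ b ≤ B, Φ b ≤ Φ' b)
    (hq : ∀ b < B, q b ≤ q' b) : ∀ b ≤ B, passageLine Φ q b ≤ passageLine Φ' q' b
  | 0, _ => le_rfl
  | b + 1, hb =>
    add_le_add (max_le_max (passageLine_mono hΦ hq b (by omega)) (hΦ _ hb)) (hq b hb)

theorem passageLine_congr {Φ Φ' q q' : ℕ → ℤ} {B : ℕ} (hΦ : ∀ b ≤ B, Φ b = Φ' b)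
    (hq : ∀ b < B, q b = q' b) (b : ℕ) (hb : b ≤ B) :
    passageLine Φ q b = passageLine Φ' q' b :=
  le_antisymm (passageLine_mono (fun b hb => (hΦ b hb).le) (fun b hb => (hq b hb).le) b hb)
    (passageLine_mono (fun b hb => (hΦ b hb).ge) (fun b hb => (hq b hb).ge) b hb)

/-- Passing the arrivals `p` and services `q` of two consecutive lines through a queue with
length `g` does not change the last passage values of the pair of lines. -/
theorem passageLine_queue {Φ p q p' q' g : ℕ → ℤ} {B : ℕ} (h0 : 0 ≤ g 0)
    (hg : ∀ b < B, g (b + 1) = q b + max (g b - p b) 0)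
    (hp : ∀ b < B, p' b = min (p b) (g b))
    (hq : ∀ b < B, q' b = q b + p b - p' b) (b : ℕ) (hb : b ≤ B) :
    passageLine (passageLine Φ p') q' b = passageLine (passageLine Φ p) q b := by
  -- Strengthened induction: `g` bounds the lead of the upper line over the lower one, and the lower
  -- line may lose value under `p'` only while that bound is attained, where the loss does not
  -- affect the upper line.
  suffices h : passageLine (passageLine Φ p') q' b = passageLine (passageLine Φ p) q b ∧
      passageLine (passageLine Φ p) q b ≤ passageLine Φ p b + g b ∧
      passageLine Φ p' b ≤ passageLine Φ p b ∧
      (passageLine Φ p b = passageLine Φ p' b ∨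
        passageLine (passageLine Φ p) q b = passageLine Φ p b + g b) from h.1
  induction b with
  | zero => simpa [passageLine] using h0
  | succ b ih =>
    obtain ⟨h1, h2, h3, h4⟩ := ih (by omega)
    have e1 := hg b hb
    have e2 := hp b hb
    have e3 := hq b hb
    simp only [passageLine, h1]
    generalize passageLine (passageLine Φ p) q b = P at *
    generalize passageLine Φ p b = E at *
    generalize passageLine Φ p' b = E' at *
    generalize Φ (b + 1) = F at *
    generalize g (b + 1) = g' at *
    generalize g b = g₀ at *
    generalize p b = p₀ at *
    generalize p' b = p₁ at *
    generalize q b = q₀ at *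
    generalize q' b = q₁ at *
    -- The invariants survive the inflow: if `F ≥ E`, then also `F ≥ E'` and both maxima equal `F`.
    have hA : P ≤ max E F + g₀ := by omega
    have hB : max E' F ≤ max E F := by omega
    have hC : max E F = max E' F ∨ P = max E F + g₀ := by omega
    generalize max E F = A at *
    generalize max E' F = A' at *
    clear h1 h2 h3 h4
    refine ⟨?_, ?_, ?_, ?_⟩ <;> omega

/-- The last passage values of the `s` lines with weights `x r, x (r + 1), …`. -/
def lastPassage (x : ℕ → ℕ → ℤ) : ℕ → ℕ → ℕ → ℤ
  | 0, _ => fun _ => 0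
  | s + 1, r => passageLine (lastPassage x s (r + 1)) (x r)

theorem lastPassage_mono {x x' : ℕ → ℕ → ℤ} {B : ℕ} (h : ∀ r, ∀ b < B, x r b ≤ x' r b) :
    ∀ s r, ∀ b ≤ B, lastPassage x s r b ≤ lastPassage x' s r b
  | 0, _, _, _ => le_rfl
  | s + 1, r, b, hb => passageLine_mono (lastPassage_mono h s (r + 1)) (h r) b hb

/-! ### Patterns as sequences of partitions -/

/-- `L i r` is the `r`-th part of the `i`-th partition of a sequence of `N` interlacing
partitions, with all parts shifted by one. -/
structure IsPattern (N : ℕ) (L : ℕ → ℕ → ℤ) : Prop where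
  one_le : ∀ i r, i ≤ N → 1 ≤ L i r
  eq_one : ∀ i r, i ≤ r → L i r = 1
  succ_le : ∀ i r, i < N → L (i + 1) (r + 1) ≤ L i r
  le_succ : ∀ i r, i < N → L i r ≤ L (i + 1) r

/-- The letterCount of the letter `d + b + 1` in the `r`-th row of the tableau of `L`. -/
def letterCount (L : ℕ → ℕ → ℤ) (d r b : ℕ) : ℤ := L (d + b + 1) r - L (d + b) r

/-- When all letters from 1 on are present, column strictness makes staying in the top row `r`
optimal. The bound `N ≤ r + s` leaves only empty rows below the `s` lines. -/
theorem IsPattern.lastPassage_zero {N : ℕ} {L : ℕ → ℕ → ℤ} (hL : IsPattern N L) :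
    ∀ s r, N ≤ r + s → ∀ b ≤ N, lastPassage (letterCount L 0) s r b = L b r - 1
  | 0, r, hr, b, hb => by simp [lastPassage, hL.eq_one b r (by omega)]
  | s + 1, r, hr, 0, hb => by simp [lastPassage, passageLine, hL.eq_one 0 r (by omega)]
  | s + 1, r, hr, b + 1, hb => by
    have h1 := hL.lastPassage_zero (s + 1) r hr b (by omega)
    have h2 := hL.lastPassage_zero s (r + 1) (by omega) (b + 1) hb
    have h3 := hL.succ_le b r hb
    simp only [lastPassage] at h1
    simp only [lastPassage, passageLine, h1, h2, letterCount, zero_add]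
    omega

/-- `M` arises from `L` by deleting the letter `1` and rectifying. -/
structure IsPromotion (N : ℕ) (L M : ℕ → ℕ → ℤ) : Prop where
  eq_one : ∀ i r, i ≤ r → M i r = 1
  zero : ∀ i, i + 1 < N →
    M (i + 1) 0 = max (L (i + 2) 1) (M i 0) + L (i + 2) 0 - L (i + 1) 0
  succ : ∀ i r, i + 1 < N → M (i + 1) (r + 1) =
    max (L (i + 2) (r + 2)) (M i (r + 1)) + min (L (i + 2) (r + 1)) (M i r) - L (i + 1) (r + 1)

/-- Supplies the nonnegative initial queue length in `IsPromotion.lastPassage_stripped`. -/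
theorem IsPromotion.le {N : ℕ} {L M : ℕ → ℕ → ℤ} (hL : IsPattern N L) (hM : IsPromotion N L M) :
    ∀ i r, i < N → L (i + 1) (r + 1) ≤ M i r
  | 0, r, _ => by rw [hM.eq_one 0 r (by omega), hL.eq_one 1 (r + 1) (by omega)]
  | i + 1, 0, hi => by
    have := hM.zero i hi
    have := hL.le_succ (i + 1) 0 hi
    simp only [zero_add, add_assoc, Nat.reduceAdd] at *
    omega
  | i + 1, r + 1, hi => by
    have := hM.succ i r hi
    have := hL.le_succ (i + 1) (r + 1) hi
    have := hM.le hL i r (by omega)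
    simp only [add_assoc, Nat.reduceAdd] at *
    omega

/-- The number of letters `e + b + 2` that move from row `r` to row `r - 1`. -/
def lifted (L M : ℕ → ℕ → ℤ) (e : ℕ) : ℕ → ℕ → ℤ
  | 0, _ => 0
  | r + 1, b => max 0 (L (e + b + 2) (r + 1) - M (e + b) r)

theorem IsPromotion.letterCount_eq {N : ℕ} {L M : ℕ → ℕ → ℤ} (hM : IsPromotion N L M)
    (e r b : ℕ) (hb : e + b + 1 < N) :
    letterCount M e r b =
      letterCount L (e + 1) r b - lifted L M e r b + lifted L M e (r + 1) b := by
  have h : e + 1 + b = e + b + 1 := by omega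
  cases r with
  | zero =>
    have := hM.zero (e + b) hb
    simp only [letterCount, lifted, h, zero_add, add_assoc, Nat.reduceAdd] at *
    omega
  | succ r =>
    have := hM.succ (e + b) r hb
    simp only [letterCount, lifted, h, add_assoc, Nat.reduceAdd] at *
    omega

/-- Rectification performed up to row `r`: the rows below are restored to those of `L`, while row
`r` has already sent its letters upwards but has not yet received any from row `r + 1`. One queue
step passes from row `r + 1` to row `r`. -/
theorem IsPromotion.lastPassage_stripped {N : ℕ} {L M : ℕ → ℕ → ℤ} (hL : IsPattern N L)
    (hM : IsPromotion N L M) (e B : ℕ) (hB : e + 1 + B ≤ N) :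
    ∀ s r, N ≤ r + s + 1 → ∀ b ≤ B, lastPassage (letterCount M e) (s + 1) r b =
      passageLine (lastPassage (letterCount L (e + 1)) s (r + 1))
        (fun b => letterCount L (e + 1) r b - lifted L M e r b) b
  | 0, r, hr, b, hb => by
    refine passageLine_congr (fun _ _ => rfl) (fun c hc => ?_) b hb
    rw [hM.letterCount_eq e r c (by omega)]
    have h1 := hM.le hL (e + c) r (by omega)
    -- Row `r + 1` is empty here, so nothing is lifted out of it.
    rw [hL.eq_one _ _ (by omega)] at h1
    rw [lifted, hL.eq_one _ _ (by omega)]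
    omega
  | s + 1, r, hr, b, hb => by
    have ih := hM.lastPassage_stripped hL e B hB s (r + 1) (by omega)
    rw [lastPassage, passageLine_congr ih (fun _ _ => rfl) b hb]
    have h (c : ℕ) : e + 1 + c = e + c + 1 := by omega
    refine passageLine_queue (g := fun b => M (e + b) r - L (e + 1 + b) (r + 1)) (B := B)
      ?_ ?_ ?_ ?_ b hb
    · simpa using hM.le hL e r (by omega)
    · intro c hc
      have := hM.letterCount_eq e r c (by omega)
      simp only [letterCount, lifted, h, add_assoc, Nat.reduceAdd] at *
      omega
    · intro c hc
      simp only [letterCount, lifted, h, add_assoc, Nat.reduceAdd] at *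
      omega
    · intro c hc
      have := hM.letterCount_eq e r c (by omega)
      omega

theorem IsPromotion.lastPassage_eq {N : ℕ} {L M : ℕ → ℕ → ℤ} (hL : IsPattern N L)
    (hM : IsPromotion N L M) {e b s : ℕ} (hb : e + 1 + b ≤ N) (hs : N ≤ s) :
    lastPassage (letterCount M e) s 0 b = lastPassage (letterCount L (e + 1)) s 0 b := by
  obtain ⟨s, rfl⟩ : ∃ t, s = t + 1 := ⟨s - 1, by omega⟩
  rw [hM.lastPassage_stripped hL e b hb s 0 (by omega) b le_rfl]
  exact passageLine_congr (fun _ _ => rfl) (fun c _ => by simp [lifted]) b le_rfl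

/-! ### Gelfand-Tsetlin triangles -/

theorem mem_triangleIndex {n i j : ℕ} : (i, j) ∈ triangleIndex n ↔ 1 ≤ j ∧ j ≤ i ∧ i ≤ n := by
  simp only [triangleIndex, Finset.mem_filter, Finset.mem_product, Finset.mem_Icc]
  omega

theorem IntArray.entry_of_mem {s : Finset (ℕ × ℕ)} (X : IntArray s) {i j : ℕ}
    (h : (i, j) ∈ s) : X.entry i j = X ⟨(i, j), h⟩ :=
  dif_pos h

theorem IsGelfandTsetlin.entry_pos {n : ℕ} {X : IntArray (triangleIndex n)}
    (hX : IsGelfandTsetlin X) {i j : ℕ} (h1 : 1 ≤ j) (h2 : j ≤ i) (h3 : i ≤ n) :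
    0 < X.entry i j := by
  rw [X.entry_of_mem (mem_triangleIndex.2 ⟨h1, h2, h3⟩)]
  exact hX.pos _

theorem isGelfandTsetlin_of_entry {n : ℕ} {X : IntArray (triangleIndex n)}
    (hpos : ∀ i j, 1 ≤ j → j ≤ i → i ≤ n → 0 < X.entry i j)
    (h : ∀ i j : ℕ, 1 ≤ j → j ≤ i → i + 1 ≤ n →
      X.entry (i + 1) j ≤ X.entry i j ∧ X.entry i j ≤ X.entry (i + 1) (j + 1)) :
    IsGelfandTsetlin X := by
  refine ⟨?_, h⟩
  rintro ⟨⟨i, j⟩, hp⟩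
  obtain ⟨h1, h2, h3⟩ := mem_triangleIndex.1 hp
  rw [← X.entry_of_mem hp]
  exact hpos i j h1 h2 h3

theorem entry_rowReflection_of_ne {n k i : ℕ} (X : IntArray (triangleIndex n)) (h : i ≠ k)
    (j : ℕ) : (rowReflection k X).entry i j = X.entry i j := by
  by_cases hm : (i, j) ∈ triangleIndex n
  · simp [IntArray.entry, hm, rowReflection, h]
  · simp [IntArray.entry, hm]

theorem entry_rowReflection {n k j : ℕ} (X : IntArray (triangleIndex n)) (h1 : 1 ≤ j)
    (h2 : j ≤ k) (h3 : k ≤ n) : (rowReflection k X).entry k j =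
      (if j = 1 then X.entry (k + 1) j else max (X.entry (k + 1) j) (X.entry (k - 1) (j - 1)))
      + (if j = k then X.entry (k + 1) (j + 1)
          else min (X.entry (k + 1) (j + 1)) (X.entry (k - 1) j))
      - X.entry k j := by
  have hm : (k, j) ∈ triangleIndex n := mem_triangleIndex.2 ⟨h1, h2, h3⟩
  rw [IntArray.entry_of_mem _ hm, IntArray.entry_of_mem X hm]
  simp [rowReflection]

theorem IsGelfandTsetlin.rowReflection_bounds {n : ℕ} {X : IntArray (triangleIndex n)}
    (hX : IsGelfandTsetlin X) {k j : ℕ} (h1 : 1 ≤ j) (h2 : j ≤ k) (h3 : k + 1 ≤ n) :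
    X.entry (k + 1) j ≤ (rowReflection k X).entry k j ∧
      (rowReflection k X).entry k j ≤ X.entry (k + 1) (j + 1) ∧
      (j ≠ 1 → X.entry (k - 1) (j - 1) ≤ (rowReflection k X).entry k j) ∧
      (j ≠ k → (rowReflection k X).entry k j ≤ X.entry (k - 1) j) := by
  rw [entry_rowReflection X h1 h2 (by omega)]
  have a := hX.interlace k j h1 h2 h3
  have b : j ≠ 1 → X.entry (k - 1) (j - 1) ≤ X.entry k j := fun hj => by
    have := (hX.interlace (k - 1) (j - 1) (by omega) (by omega) (by omega)).2
    rwa [show k - 1 + 1 = k by omega, show j - 1 + 1 = j by omega] at this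
  have c : j ≠ k → X.entry k j ≤ X.entry (k - 1) j := fun hj => by
    have := (hX.interlace (k - 1) j (by omega) (by omega) (by omega)).1
    rwa [show k - 1 + 1 = k by omega] at this
  split_ifs with e1 e2 e2
  · refine ⟨?_, ?_, fun h => absurd e1 h, fun h => absurd e2 h⟩ <;> omega
  · have := c e2
    refine ⟨?_, ?_, fun h => absurd e1 h, fun h => ?_⟩ <;> omega
  · have := b e1
    refine ⟨?_, ?_, fun h => ?_, fun h => absurd e2 h⟩ <;> omega
  · have := b e1
    have := c e2
    refine ⟨?_, ?_, fun h => ?_, fun h => ?_⟩ <;> omega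

theorem IsGelfandTsetlin.map_rowReflection {n k : ℕ} {X : IntArray (triangleIndex n)}
    (hX : IsGelfandTsetlin X) (hk : k + 1 ≤ n) : IsGelfandTsetlin (rowReflection k X) := by
  refine isGelfandTsetlin_of_entry (fun i j h1 h2 h3 => ?_) (fun i j h1 h2 h3 => ?_)
  · by_cases hi : i = k
    · subst hi
      exact (hX.entry_pos h1 (by omega) hk).trans_le (hX.rowReflection_bounds h1 h2 hk).1
    · rw [entry_rowReflection_of_ne X hi]
      exact hX.entry_pos h1 h2 h3
  · by_cases hi : i = k
    · subst hi
      have := hX.rowReflection_bounds h1 h2 hk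
      rw [entry_rowReflection_of_ne X (i := i + 1) (by omega),
        entry_rowReflection_of_ne X (i := i + 1) (by omega)]
      exact ⟨this.1, this.2.1⟩
    · rw [entry_rowReflection_of_ne X hi]
      by_cases hi' : i + 1 = k
      · subst hi'
        exact ⟨(hX.rowReflection_bounds h1 (by omega) hk).2.2.2 (by omega),
          (hX.rowReflection_bounds (by omega) (by omega) hk).2.2.1 (by omega)⟩
      · rw [entry_rowReflection_of_ne X hi', entry_rowReflection_of_ne X hi']
        exact hX.interlace i j h1 h2 h3

theorem IsGelfandTsetlin.map_rowSweep {n : ℕ} {X : IntArray (triangleIndex n)}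
    (hX : IsGelfandTsetlin X) : ∀ m, m + 1 ≤ n → IsGelfandTsetlin (rowSweep m X)
  | 0, _ => hX
  | m + 1, hm => (hX.map_rowSweep m (by omega)).map_rowReflection hm

theorem IsGelfandTsetlin.map_sweepProduct {n : ℕ} : ∀ m (X : IntArray (triangleIndex n)),
    IsGelfandTsetlin X → m + 1 ≤ n → IsGelfandTsetlin (sweepProduct m X)
  | 0, _, hX, _ => hX
  | m + 1, _, hX, hm => map_sweepProduct m _ (hX.map_rowSweep (m + 1) hm) (by omega)

theorem entry_rowSweep_of_lt {n : ℕ} (X : IntArray (triangleIndex n)) (i j : ℕ) :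
    ∀ m, m < i → (rowSweep m X).entry i j = X.entry i j
  | 0, _ => rfl
  | m + 1, hm => by
    rw [rowSweep, Function.comp, entry_rowReflection_of_ne _ (by omega),
      entry_rowSweep_of_lt X i j m (by omega)]

theorem entry_sweepProduct_of_lt {n : ℕ} (i j : ℕ) : ∀ m (X : IntArray (triangleIndex n)),
    m < i → (sweepProduct m X).entry i j = X.entry i j
  | 0, _, _ => rfl
  | m + 1, X, hm => by
    rw [sweepProduct, Function.comp, entry_sweepProduct_of_lt i j m _ (by omega),
      entry_rowSweep_of_lt X i j _ hm]

/-- When `s_k` acts, row `k - 1` is already new and row `k + 1` is still old. -/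
theorem entry_rowSweep {n : ℕ} (X : IntArray (triangleIndex n)) {k j : ℕ} (h1 : 1 ≤ j)
    (h2 : j ≤ k) : ∀ m, k ≤ m → m ≤ n → (rowSweep m X).entry k j =
      (if j = 1 then X.entry (k + 1) j
        else max (X.entry (k + 1) j) ((rowSweep m X).entry (k - 1) (j - 1)))
      + (if j = k then X.entry (k + 1) (j + 1)
          else min (X.entry (k + 1) (j + 1)) ((rowSweep m X).entry (k - 1) j))
      - X.entry k j
  | 0, hk, _ => by omega
  | m + 1, hk, hm => by
    rw [rowSweep, Function.comp]
    rcases hk.eq_or_lt with rfl | hk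
    · rw [entry_rowReflection _ h1 h2 hm, entry_rowReflection_of_ne _ (by omega),
        entry_rowReflection_of_ne _ (by omega)]
      simp only [entry_rowSweep_of_lt X _ _ m (show m < m + 1 + 1 by omega),
        entry_rowSweep_of_lt X _ _ m (show m < m + 1 by omega)]
    · rw [entry_rowReflection_of_ne _ (by omega), entry_rowReflection_of_ne _ (by omega),
        entry_rowReflection_of_ne _ (by omega)]
      exact entry_rowSweep X h1 h2 m (by omega) (by omega)

/-- The triangle `X` as a sequence of partitions, with parts `X_{i,i-r}` in the `i`-th one. -/
def partitionSeq {n : ℕ} (X : IntArray (triangleIndex n)) (i r : ℕ) : ℤ :=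
  if r < i then X.entry i (i - r) else 1

theorem partitionSeq_eq_entry {n i r j : ℕ} (X : IntArray (triangleIndex n)) (h : i = r + j)
    (hj : 1 ≤ j) : partitionSeq X i r = X.entry i j := by
  rw [partitionSeq, if_pos (by omega), show i - r = j by omega]

theorem IsGelfandTsetlin.isPattern {n : ℕ} {X : IntArray (triangleIndex n)}
    (hX : IsGelfandTsetlin X) {N : ℕ} (hN : N ≤ n) : IsPattern N (partitionSeq X) := by
  have one_le : ∀ i r, i ≤ N → 1 ≤ partitionSeq X i r := fun i r hi => by
    rw [partitionSeq]
    split_ifs with h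
    · exact hX.entry_pos (by omega) (by omega) (by omega)
    · exact le_rfl
  refine ⟨one_le, fun i r h => if_neg (by omega), fun i r hi => ?_, fun i r hi => ?_⟩
  · by_cases h : r < i
    · rw [partitionSeq, partitionSeq, if_pos h, if_pos (by omega), Nat.add_sub_add_right]
      exact (hX.interlace i (i - r) (by omega) (by omega) (by omega)).1
    · rw [partitionSeq, if_neg (by omega)]
      exact one_le i r (by omega)
  · by_cases h : r < i
    · rw [partitionSeq, partitionSeq, if_pos h, if_pos (by omega),
        show i + 1 - r = i - r + 1 by omega]
      exact (hX.interlace i (i - r) (by omega) (by omega) (by omega)).2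
    · rw [partitionSeq, if_neg h]
      exact one_le (i + 1) r (by omega)

/-- An entry omitted from a maximum becomes the default part 1, which is harmless since all entries
are at least 1; an omitted minimum is the case of part 0. -/
theorem IsGelfandTsetlin.isPromotion_rowSweep {n : ℕ} {X : IntArray (triangleIndex n)}
    (hX : IsGelfandTsetlin X) {m : ℕ} (hm : m + 1 ≤ n) :
    IsPromotion (m + 1) (partitionSeq X) (partitionSeq (rowSweep m X)) := by
  have hY := (hX.map_rowSweep m hm).isPattern (N := n) le_rfl
  have hP := hX.isPattern (N := n) le_rfl
  refine ⟨fun i r h => if_neg (by omega), fun i hi => ?_, fun i r hi => ?_⟩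
  · have h := entry_rowSweep X (k := i + 1) (j := i + 1) (by omega) le_rfl m (by omega) (by omega)
    have h1 := hP.one_le (i + 2) 1 (by omega)
    rw [if_pos rfl] at h
    rw [partitionSeq_eq_entry X (j := i + 1) (by omega) (by omega)] at h1
    rw [partitionSeq_eq_entry _ (j := i + 1) (by omega) (by omega),
      partitionSeq_eq_entry X (i := i + 2) (j := i + 1) (by omega) (by omega),
      partitionSeq_eq_entry X (j := i + 2) (by omega) (by omega),
      partitionSeq_eq_entry X (i := i + 1) (j := i + 1) (by omega) (by omega), h]
    rcases Nat.eq_zero_or_pos i with rfl | h0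
    · rw [if_pos rfl, hY.eq_one 0 0 le_rfl, max_eq_left h1]
    · rw [if_neg (by omega), partitionSeq_eq_entry _ (j := i) (by omega) h0]
      rfl
  · by_cases hr : r < i
    · obtain ⟨j, rfl⟩ := Nat.exists_eq_add_of_lt hr
      have h := entry_rowSweep X (k := r + j + 1 + 1) (j := j + 1) (by omega) (by omega) m
        (by omega) (by omega)
      have h1 := hP.one_le (r + j + 1 + 2) (r + 2) (by omega)
      rw [if_neg (show j + 1 ≠ r + j + 1 + 1 by omega)] at h
      rw [partitionSeq_eq_entry X (j := j + 1) (by omega) (by omega)] at h1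
      rw [partitionSeq_eq_entry _ (i := r + j + 1 + 1) (j := j + 1) (by omega) (by omega),
        partitionSeq_eq_entry X (r := r + 2) (j := j + 1) (by omega) (by omega),
        partitionSeq_eq_entry X (i := r + j + 1 + 2) (j := j + 2) (by omega) (by omega),
        partitionSeq_eq_entry _ (r := r) (j := j + 1) (by omega) (by omega),
        partitionSeq_eq_entry X (j := j + 1) (by omega) (by omega), h]
      rcases Nat.eq_zero_or_pos j with rfl | h0
      · rw [if_pos rfl, hY.eq_one _ _ (by omega), max_eq_left h1]
        rfl
      · rw [if_neg (by omega), partitionSeq_eq_entry _ (j := j) (by omega) h0]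
        rfl
    · have h1 := hP.one_le (i + 2) (r + 1) (by omega)
      rw [hP.eq_one (i + 2) (r + 2) (by omega), hP.eq_one (i + 1) (r + 1) (by omega),
        hY.eq_one (i + 1) (r + 1) (by omega), hY.eq_one i (r + 1) (by omega),
        hY.eq_one i r (by omega)]
      omega

/-- The diagonal entries of the image under the Schützenberger involution as last passage
values. -/
theorem IsGelfandTsetlin.entry_sweepProduct {n : ℕ} : ∀ (m : ℕ) (X : IntArray (triangleIndex n)),
    IsGelfandTsetlin X → m + 1 ≤ n → ∀ j, 1 ≤ j → j ≤ m + 1 → (sweepProduct m X).entry j j =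
      1 + lastPassage (letterCount (partitionSeq X) (m + 1 - j)) n 0 j := by
  have top : ∀ (m : ℕ) (X : IntArray (triangleIndex n)), IsGelfandTsetlin X → m + 1 ≤ n →
      (sweepProduct m X).entry (m + 1) (m + 1) = 1 +
        lastPassage (letterCount (partitionSeq X) (m + 1 - (m + 1))) n 0 (m + 1) := by
    intro m X hX hm
    rw [entry_sweepProduct_of_lt _ _ m X (by omega), Nat.sub_self,
      (hX.isPattern hm).lastPassage_zero n 0 (by omega) (m + 1) le_rfl, partitionSeq,
      if_pos (by omega), Nat.sub_zero]
    ring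
  intro m
  induction m with
  | zero =>
    intro X hX hm j h1 h2
    obtain rfl : j = 0 + 1 := by omega
    exact top 0 X hX hm
  | succ m ih =>
    intro X hX hm j h1 h2
    rcases h2.eq_or_lt with rfl | h2
    · exact top (m + 1) X hX hm
    -- Each sweep lowers the letters by one, so the window starts one letter later in `X`.
    · rw [sweepProduct, Function.comp, ih _ (hX.map_rowSweep (m + 1) hm) (by omega) j h1 (by omega),
        (hX.isPromotion_rowSweep hm).lastPassage_eq (hX.isPattern hm) (by omega) (by omega),
        show m + 1 - j + 1 = m + 1 + 1 - j by omega]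

/-- If the tableau of `C` has at most the letters of the tableau of `T` in each row, and `T` is
GOGAm, then so is `C`. -/
theorem IsGOGAm.of_letterCount_le {n : ℕ} {T C : IntArray (triangleIndex n)} (hT : IsGOGAm T)
    (hC : IsGelfandTsetlin C)
    (h : ∀ r i, i < n → partitionSeq C (i + 1) r - partitionSeq C i r ≤
      partitionSeq T (i + 1) r - partitionSeq T i r) : IsGOGAm C := by
  rcases Nat.eq_zero_or_pos n with rfl | hn
  · exact ⟨hC, hC, fun j h1 h2 => by omega⟩
  refine ⟨hC, IsGelfandTsetlin.map_sweepProduct _ C hC (by omega), fun j h1 h2 => ?_⟩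
  refine le_trans ?_ (hT.magog.diagonal j h1 h2)
  rw [schutzenberger, schutzenberger, hC.entry_sweepProduct _ _ (by omega) j h1 (by omega),
    hT.gelfandTsetlin.entry_sweepProduct _ _ (by omega) j h1 (by omega)]
  gcongr
  exact lastPassage_mono (fun r b hb => h r _ (by omega)) n 0 j le_rfl

/-! ### Completions -/

/-- The array `T` with the entries outside of the right trapezoid replaced by `1`. -/
def rightFill {n : ℕ} (k : ℕ) (T : IntArray (triangleIndex n)) : IntArray (triangleIndex n) :=
  fun p => if p.1.1 < p.1.2 + k then T p else 1

theorem entry_rightFill {n k i j : ℕ} (T : IntArray (triangleIndex n)) (h1 : 1 ≤ j) (h2 : j ≤ i)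
    (h3 : i ≤ n) : (rightFill k T).entry i j = if i < j + k then T.entry i j else 1 := by
  have hm : (i, j) ∈ triangleIndex n := mem_triangleIndex.2 ⟨h1, h2, h3⟩
  rw [IntArray.entry_of_mem _ hm, IntArray.entry_of_mem T hm]
  rfl

/-- The filling empties the tableau rows with index at least `k` and keeps the others. -/
theorem IsGOGAm.map_rightFill {n : ℕ} (k : ℕ) {T : IntArray (triangleIndex n)} (hT : IsGOGAm T) :
    IsGOGAm (rightFill k T) := by
  have hG := hT.gelfandTsetlin
  have hC : IsGelfandTsetlin (rightFill k T) := by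
    refine isGelfandTsetlin_of_entry (fun i j h1 h2 h3 => ?_) (fun i j h1 h2 h3 => ?_)
    · have := hG.entry_pos h1 h2 h3
      rw [entry_rightFill T h1 h2 h3]
      split_ifs <;> omega
    · have := hG.entry_pos h1 h2 (by omega)
      have := hG.interlace i j h1 h2 h3
      rw [entry_rightFill T h1 h2 (by omega), entry_rightFill T h1 (by omega) h3,
        entry_rightFill T (by omega) (by omega) h3]
      split_ifs <;> omega
  refine hT.of_letterCount_le hC fun r i hi => ?_
  have hp := hG.isPattern (N := n) le_rfl
  have key : ∀ i ≤ n, partitionSeq (rightFill k T) i r =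
      if r < k then partitionSeq T i r else 1 := fun i hi => by
    by_cases h : r < i
    · rw [partitionSeq, partitionSeq, if_pos h, if_pos h,
        entry_rightFill T (by omega) (by omega) hi]
      exact if_congr (by omega) rfl rfl
    · simp [partitionSeq, h]
  have := hp.le_succ i r hi
  rw [key i (by omega), key (i + 1) (by omega)]
  split_ifs <;> omega

/-- The array `T` with the entries to the right of the `k`-th NW-SE diagonal replaced by the
entries of this diagonal, constant on SW-NE diagonals. -/
def leftFill {n : ℕ} (k : ℕ) (T : IntArray (triangleIndex n)) : IntArray (triangleIndex n) :=
  fun p => if p.1.2 ≤ k then T p else T.entry (p.1.1 - p.1.2 + k) k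

theorem entry_leftFill {n k i j : ℕ} (T : IntArray (triangleIndex n)) (h1 : 1 ≤ j) (h2 : j ≤ i)
    (h3 : i ≤ n) :
    (leftFill k T).entry i j = if j ≤ k then T.entry i j else T.entry (i - j + k) k := by
  have hm : (i, j) ∈ triangleIndex n := mem_triangleIndex.2 ⟨h1, h2, h3⟩
  rw [IntArray.entry_of_mem _ hm, IntArray.entry_of_mem T hm]
  rfl

/-- The filling removes from row `r` of the tableau exactly the letters above `r + k`. -/
theorem IsGOGAm.map_leftFill {n k : ℕ} (hk : 1 ≤ k) {T : IntArray (triangleIndex n)}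
    (hT : IsGOGAm T) : IsGOGAm (leftFill k T) := by
  have hG := hT.gelfandTsetlin
  have hC : IsGelfandTsetlin (leftFill k T) := by
    refine isGelfandTsetlin_of_entry (fun i j h1 h2 h3 => ?_) (fun i j h1 h2 h3 => ?_)
    · rw [entry_leftFill T h1 h2 h3]
      split_ifs with h
      · exact hG.entry_pos h1 h2 h3
      · exact hG.entry_pos hk (by omega) (by omega)
    · rw [entry_leftFill T h1 h2 (by omega), entry_leftFill T h1 (by omega) h3,
        entry_leftFill T (by omega) (by omega) h3]
      rcases lt_trichotomy j k with h | rfl | h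
      · rw [if_pos h.le, if_pos h.le, if_pos (by omega)]
        exact hG.interlace i j h1 h2 h3
      · rw [if_pos le_rfl, if_pos le_rfl, if_neg (by omega),
          show i + 1 - (j + 1) + j = i by omega]
        exact ⟨(hG.interlace i j h1 h2 h3).1, le_rfl⟩
      · rw [if_neg (by omega), if_neg (by omega), if_neg (by omega), Nat.add_sub_add_right,
          show i + 1 - j + k = i - j + k + 1 by omega]
        exact ⟨(hG.interlace (i - j + k) k hk (by omega) (by omega)).1, le_rfl⟩
  refine hT.of_letterCount_le hC fun r i hi => ?_
  have hp := hG.isPattern (N := n) le_rfl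
  have key : ∀ i ≤ n, partitionSeq (leftFill k T) i r =
      if i ≤ r + k then partitionSeq T i r else partitionSeq T (r + k) r := fun i hi => by
    by_cases h : r < i
    · rw [partitionSeq_eq_entry T (i := r + k) rfl hk, partitionSeq, partitionSeq, if_pos h,
        if_pos h, entry_leftFill T (by omega) (by omega) hi, show i - (i - r) = r by omega]
      exact if_congr (by omega) rfl rfl
    · simp [partitionSeq, h, show i ≤ r + k by omega]
  have := hp.le_succ i r hi
  rw [key i (by omega), key (i + 1) (by omega)]
  split_ifs with h1 h2 h2
  · exact le_rfl
  · omega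
  · obtain rfl : i = r + k := by omega
    omega
  · omega

theorem IsGelfandTsetlin.entry_diagonal_mono {n : ℕ} {X : IntArray (triangleIndex n)}
    (hX : IsGelfandTsetlin X) {i j : ℕ} (h1 : 1 ≤ j) (h2 : j ≤ i) :
    ∀ t, i + t ≤ n → X.entry i j ≤ X.entry (i + t) (j + t)
  | 0, _ => le_rfl
  | t + 1, ht => (hX.entry_diagonal_mono h1 h2 t (by omega)).trans
      (hX.interlace (i + t) (j + t) (by omega) (by omega) ht).2

theorem mainTheorem5 (n k : ℕ) (hk : 1 ≤ k) (hkn : k ≤ n) :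
    (∀ X : IntArray (rightIndex n k), IsRightGOGAmTrapezoid X →
      ∃ C : IntArray (triangleIndex n), IsRightCompletion X C ∧
        ∀ i j : ℕ, 1 ≤ j → j + k ≤ i → i ≤ n → C.entry i j = 1) ∧
    (∀ X : IntArray (leftIndex n k), IsLeftGOGAmTrapezoid X →
      ∃ C : IntArray (triangleIndex n), IsLeftCompletion X C ∧
        ∀ i j : ℕ, k ≤ j → j ≤ i → i ≤ n → C.entry i j = X.entry (i - j + k) k) := by
  constructor
  · rintro X ⟨T, hT, hTX⟩
    refine ⟨rightFill k T, ⟨⟨hT.map_rightFill k, fun p hp => ?_⟩, ?_⟩, fun i j h1 h2 h3 => ?_⟩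
    · rw [← hTX p hp]
      exact if_pos (Finset.mem_filter.1 hp).2
    · rintro T' ⟨hT', hTX'⟩ p
      rw [rightFill]
      split_ifs with h
      · have hp : p.1 ∈ rightIndex n k := Finset.mem_filter.2 ⟨p.2, h⟩
        exact ((hTX p.1 hp).trans (hTX' p.1 hp).symm).le
      · exact hT'.gelfandTsetlin.pos p
    · rw [entry_rightFill T h1 (by omega) h3, if_neg (by omega)]
  · rintro X ⟨T, hT, hTX⟩
    have hmem : ∀ i ≤ n, k ≤ i → (i, k) ∈ leftIndex n k := fun i hi hki =>
      Finset.mem_filter.2 ⟨mem_triangleIndex.2 ⟨hk, hki, hi⟩, le_rfl⟩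
    have hext : ∀ T : IntArray (triangleIndex n), ExtendsLeft T X → ∀ i ≤ n, k ≤ i →
        T.entry i k = X.entry i k := fun T hTX i hi hki => by
      rw [X.entry_of_mem (hmem i hi hki),
        T.entry_of_mem (leftIndex_subset n k (hmem i hi hki))]
      exact hTX _ _
    refine ⟨leftFill k T, ⟨⟨hT.map_leftFill hk, fun p hp => ?_⟩, ?_⟩, fun i j h1 h2 h3 => ?_⟩
    · rw [← hTX p hp]
      exact if_pos (Finset.mem_filter.1 hp).2
    · rintro T' ⟨hT', hTX'⟩ ⟨⟨i, j⟩, hm⟩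
      obtain ⟨h1, h2, h3⟩ := mem_triangleIndex.1 hm
      rw [leftFill]
      split_ifs with h
      · have hp : (i, j) ∈ leftIndex n k := Finset.mem_filter.2 ⟨hm, h⟩
        exact ((hTX _ hp).trans (hTX' _ hp).symm).le
      · simp only at h ⊢
        rw [hext T hTX _ (by omega) (by omega), ← hext T' hTX' _ (by omega) (by omega),
          ← T'.entry_of_mem hm]
        have := hT'.gelfandTsetlin.entry_diagonal_mono hk (Nat.le_add_left k (i - j)) (j - k)
          (by omega)
        rwa [show i - j + k + (j - k) = i by omega, show k + (j - k) = j by omega] at this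
    · rw [entry_leftFill T (by omega) h2 h3, ← hext T hTX _ (by omega) (by omega)]
      split_ifs with h
      · obtain rfl : j = k := by omega
        rw [show i - j + j = i by omega]
      · rfl
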